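/- Let $G$ be a finite simple undirected graph on $n\ge 1$ vertices, and let $\rho(G)$ denote its spectral radius, that is, the largest eigenvalue of its adjacency matrix. If $\rho(G)\geq n-2$, then $G$ contains a Hamilton path (a path visiting every vertex exactly once) unless $G=K_{n-1}+K_1$, the disjoint union of a complete graph on $n-1$ vertices and a single vertex. (For $n\ge 2$ the graph $K_{n-1}+K_1$ contains no Hamilton path.) -/

import Mathlib

namespace SimpleGraph

/-- The spectral radius `ρ(G)`: the largest eigenvalue of the (real symmetric) adjacency matrix of a
finite nonempty graph. -/
noncomputable def rho {V : Type*} [Fintype V] [Nonempty V] [DecidableEq V]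
    (G : SimpleGraph V) [DecidableRel G.Adj] : ℝ :=
  Finset.univ.sup' Finset.univ_nonempty (G.isHermitian_adjMatrix ℝ).eigenvalues

/-- `G` contains a Hamilton path: a walk visiting every vertex exactly once. -/
def HasHamiltonPath {V : Type*} [DecidableEq V] (G : SimpleGraph V) : Prop :=
  ∃ (u v : V) (p : G.Walk u v), p.IsHamiltonian

end SimpleGraph

/-! Stanley's bound gives `ρ (ρ + 1) ≤ 2m`. For `n ≥ 2`, `ρ ≥ n - 2` then yields `2m ≥ (n - 2)(n -
1)`, so at most `n - 1` pairs are non-adjacent. The rest is combinatorial: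
`traceableOn_or_isolated_or_isClawOn` says that such a graph is traceable, has an isolated vertex,
or is `K_{1,3}`. An isolated vertex already accounts for `n - 1` non-edges, so the other vertices
form a clique. The claw is excluded because its spectral radius is below `2 = n - 2`.

The trichotomy goes by induction, deleting a vertex that lies on a non-edge but is adjacent to at
least half of the others. The non-edge budget falls along with the order, and such a vertex can be
put back into any path through the rest. -/

namespace SimpleGraph

/-! ### Graphs with few non-edges -/

section Traceable

variable {V : Type*} [DecidableEq V] (G : SimpleGraph V)

/-- Some ordering of the vertices of `S` without repetition is a path of `G`. -/
def TraceableOn (S : Finset V) : Prop :=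
  ∃ l : List V, l.Nodup ∧ l.toFinset = S ∧ l.IsChain G.Adj

variable [DecidableRel G.Adj]

/-- The number of vertices of `S` different from `u` and not adjacent to `u`. -/
def nonDegree (S : Finset V) (u : V) : ℕ := (S.filter (Gᶜ.Adj u)).card

variable {G}

omit [DecidableEq V] in
/-- A vertex not adjacent to the head of a path can be inserted after the head, unless at most half
of the other vertices are neighbours. -/
theorem exists_insert_chain_or (v : V) : ∀ (n : ℕ) (a : V) (t : List V), t.length ≤ n →
    (a :: t).IsChain G.Adj → ¬ G.Adj v a →
    (∃ t', t'.Perm (v :: t) ∧ (a :: t').IsChain G.Adj) ∨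
      2 * (t.filter (fun x => G.Adj v x)).length ≤ t.length := by
  intro n
  induction n with
  | zero =>
    intro a t ht _ _
    have : t = [] := List.length_eq_zero_iff.1 (by omega)
    subst this
    simp
  | succ n ih =>
    intro a t ht hc ha
    match t with
    | [] => simp
    | b :: s =>
      rw [List.isChain_cons_cons] at hc
      obtain ⟨hab, hc⟩ := hc
      by_cases hb : G.Adj v b
      · match s with
        | [] => exact Or.inl ⟨[b, v], List.Perm.swap _ _ _, by simp [hab, hb.symm]⟩
        | c :: s' =>
          rw [List.isChain_cons_cons] at hc
          by_cases hvc : G.Adj v c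
          · refine Or.inl ⟨b :: v :: c :: s', List.Perm.swap _ _ _, ?_⟩
            simp only [List.isChain_cons_cons]
            exact ⟨hab, hb.symm, hvc, hc.2⟩
          -- The neighbour `b` is followed by the non-neighbour `c`: the pair adds two vertices and
          -- one neighbour, so restarting at `c` preserves the bound.
          · rcases ih c s' (by simp at ht; omega) hc.2 hvc with ⟨t', hp, ht'⟩ | h
            · refine Or.inl ⟨b :: c :: t', ?_, ?_⟩
              · refine (((hp.cons c).trans (List.Perm.swap _ _ _)).cons b).trans
                  (List.Perm.swap _ _ _)
              · simp only [List.isChain_cons_cons]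
                exact ⟨hab, hc.1, ht'⟩
            · right
              simp [hb, hvc]
              omega
      · rcases ih b s (by simp at ht; omega) hc hb with ⟨t', hp, ht'⟩ | h
        · refine Or.inl ⟨b :: t', (hp.cons b).trans (List.Perm.swap _ _ _), ?_⟩
          rw [List.isChain_cons_cons]
          exact ⟨hab, ht'⟩
        · right
          simp [hb]
          omega

theorem card_filter_adj_add_nonDegree {S : Finset V} {v : V} (hv : v ∈ S) :
    (S.filter (G.Adj v)).card + G.nonDegree S v + 1 = S.card := by
  have h1 : (S.erase v).filter (G.Adj v) = S.filter (G.Adj v) := by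
    ext x
    simp only [Finset.mem_filter, Finset.mem_erase]
    exact ⟨fun h => ⟨h.1.2, h.2⟩, fun h => ⟨⟨h.2.ne', h.1⟩, h.2⟩⟩
  have h2 : (S.erase v).filter (fun x => ¬ G.Adj v x) = S.filter (Gᶜ.Adj v) := by
    ext x
    simp only [Finset.mem_filter, Finset.mem_erase, compl_adj]
    tauto
  have h := Finset.card_filter_add_card_filter_not (s := S.erase v) (G.Adj v)
  rw [h1, h2] at h
  have := Finset.card_erase_add_one hv
  unfold nonDegree
  omega

theorem nonDegree_eq_erase_add {S : Finset V} {v : V} (hv : v ∈ S) (u : V) :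
    G.nonDegree S u = G.nonDegree (S.erase v) u + if Gᶜ.Adj v u then 1 else 0 := by
  unfold nonDegree
  rw [← Finset.insert_erase hv, Finset.filter_insert, Finset.erase_insert (by simp)]
  by_cases h : Gᶜ.Adj u v
  · rw [if_pos h, if_pos h.symm, Finset.card_insert_of_notMem (by simp)]
  · rw [if_neg h, if_neg fun h' => h h'.symm, add_zero]

/-- The sum counts each non-edge twice, once from each end. -/
theorem sum_nonDegree_eq_erase_add {S : Finset V} {v : V} (hv : v ∈ S) :
    ∑ u ∈ S, G.nonDegree S u =
      ∑ u ∈ S.erase v, G.nonDegree (S.erase v) u + 2 * G.nonDegree S v := by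
  rw [← Finset.add_sum_erase S _ hv, Finset.sum_congr rfl fun u _ => nonDegree_eq_erase_add hv u,
    Finset.sum_add_distrib, ← Finset.card_filter]
  have h : ((S.erase v).filter (Gᶜ.Adj v)) = S.filter (Gᶜ.Adj v) := by
    ext x
    simp only [Finset.mem_filter, Finset.mem_erase]
    exact ⟨fun h => ⟨h.1.2, h.2⟩, fun h => ⟨⟨h.2.ne', h.1⟩, h.2⟩⟩
  rw [h]
  change G.nonDegree S v + (_ + G.nonDegree S v) = _
  ring

theorem adj_of_nonDegree_eq_zero {S : Finset V} {u x : V} (h : G.nonDegree S u = 0) (hx : x ∈ S)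
    (hne : u ≠ x) : G.Adj u x := by
  by_contra hc
  have : x ∈ S.filter (Gᶜ.Adj u) := by simp [hx, hne, hc]
  rw [Finset.card_eq_zero.1 h] at this
  simp at this

theorem not_adj_of_nonDegree {S : Finset V} {u : V} (hu : u ∈ S)
    (h : S.card ≤ G.nonDegree S u + 1) : ∀ x ∈ S, ¬ G.Adj u x := by
  have := card_filter_adj_add_nonDegree (G := G) hu
  have h0 : (S.filter (G.Adj u)).card = 0 := by omega
  intro x hx hc
  have : x ∈ S.filter (G.Adj u) := by simp [hx, hc]
  rw [Finset.card_eq_zero.1 h0] at this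
  simp at this

theorem nonDegree_add_one_of_not_adj {S : Finset V} {u : V} (hu : u ∈ S)
    (h : ∀ x ∈ S, ¬ G.Adj u x) : G.nonDegree S u + 1 = S.card := by
  have := card_filter_adj_add_nonDegree (G := G) hu
  rw [Finset.filter_false_of_mem h] at this
  simpa using this

omit [DecidableEq V] [DecidableRel G.Adj] in
/-- The vertices of a clique in any order form a path. -/
theorem isChain_toList {S : Finset V} (h : ∀ u ∈ S, ∀ x ∈ S, u ≠ x → G.Adj u x) :
    S.toList.IsChain G.Adj := by
  apply List.Pairwise.isChain
  refine (Finset.nodup_toList S).imp_of_mem ?_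
  intro a b ha hb hab
  exact h a (by simpa using ha) b (by simpa using hb) hab

/-- A path missing one vertex `v` extends when `v` has enough neighbours. -/
theorem TraceableOn.of_erase {S : Finset V} {v : V} (hv : v ∈ S) (h : G.TraceableOn (S.erase v))
    (hd : 2 * G.nonDegree S v + 1 ≤ S.card) : G.TraceableOn S := by
  obtain ⟨l, hnd, hS, hc⟩ := h
  have hvl : v ∉ l := by
    rw [← List.mem_toFinset, hS]
    simp
  have key : ∀ l' : List V, l'.Perm (v :: l) → l'.IsChain G.Adj → G.TraceableOn S := by
    intro l' hp hc'
    refine ⟨l', hp.nodup_iff.2 (List.nodup_cons.2 ⟨hvl, hnd⟩), ?_, hc'⟩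
    rw [List.toFinset_eq_of_perm _ _ hp, List.toFinset_cons, hS, Finset.insert_erase hv]
  match l with
  | [] => exact key [v] (List.Perm.refl _) (by simp)
  | a :: t =>
    by_cases ha : G.Adj v a
    · exact key _ (List.Perm.refl _) (List.isChain_cons_cons.2 ⟨ha, hc⟩)
    rcases exists_insert_chain_or v _ a t le_rfl hc ha with ⟨t', hp, ht'⟩ | h
    · exact key _ ((hp.cons a).trans (List.Perm.swap _ _ _)) ht'
    · exfalso
      have h1 := card_filter_adj_add_nonDegree (G := G) hv
      have h2 : S.filter (G.Adj v) = (t.filter (fun x => G.Adj v x)).toFinset := by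
        rw [← Finset.insert_erase hv, ← hS]
        ext x
        simp only [Finset.mem_filter, Finset.mem_insert, List.mem_toFinset, List.mem_cons,
          List.mem_filter, decide_eq_true_eq]
        constructor
        · rintro ⟨rfl | rfl | h, hx⟩
          · exact absurd hx (G.loopless.irrefl _)
          · exact absurd hx ha
          · exact ⟨h, hx⟩
        · exact fun h => ⟨Or.inr (Or.inr h.1), h.2⟩
      rw [h2, List.toFinset_card_of_nodup ((List.nodup_cons.1 hnd).2.filter _)] at h1
      have h3 := Finset.card_erase_add_one hv
      rw [← hS, List.toFinset_card_of_nodup hnd, List.length_cons] at h3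
      omega

omit [DecidableRel G.Adj] in
theorem traceableOn_of_nodup {S : Finset V} (l : List V) (hnd : l.Nodup) (hl : ∀ x ∈ l, x ∈ S)
    (hcard : S.card ≤ l.length) (hc : l.IsChain G.Adj) : G.TraceableOn S := by
  refine ⟨l, hnd, Finset.eq_of_subset_of_card_le ?_ ?_, hc⟩
  · intro x hx
    exact hl x (by simpa using hx)
  · rwa [List.toFinset_card_of_nodup hnd]

variable (G) in
/-- The induced subgraph on `S` is the star `K_{1,3}`. -/
def IsClawOn (S : Finset V) : Prop :=
  S.card = 4 ∧ ∃ c ∈ S, (∀ u ∈ S, u ≠ c → G.Adj c u) ∧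
    ∀ u ∈ S, ∀ x ∈ S, u ≠ c → x ≠ c → ¬ G.Adj u x

/-- If each vertex with a non-neighbour has many of them, the graph is tiny. -/
theorem isolated_or_isClawOn {S : Finset V} (hsum : ∑ u ∈ S, G.nonDegree S u + 2 ≤ 2 * S.card)
    {z : V} (hz : z ∈ S) (hz0 : G.nonDegree S z ≠ 0)
    (hbig : ∀ v ∈ S, G.nonDegree S v ≠ 0 → S.card ≤ 2 * G.nonDegree S v) :
    (∃ w ∈ S, ∀ x ∈ S, ¬ G.Adj w x) ∨ G.IsClawOn S := by
  set T := insert z (S.filter (Gᶜ.Adj z)) with hT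
  have hTS : T ⊆ S := by
    rw [hT, Finset.insert_subset_iff]
    exact ⟨hz, Finset.filter_subset _ _⟩
  have hTc : T.card = G.nonDegree S z + 1 := by
    rw [hT, Finset.card_insert_of_notMem (by simp)]
    rfl
  have hTbig : ∀ t ∈ T, S.card ≤ 2 * G.nonDegree S t := by
    intro t ht
    refine hbig t (hTS ht) ?_
    rw [hT, Finset.mem_insert] at ht
    rcases ht with rfl | ht
    · exact hz0
    · rw [Finset.mem_filter] at ht
      refine Finset.card_ne_zero_of_mem (a := z) ?_
      simp only [Finset.mem_filter]
      exact ⟨hz, ht.2.symm⟩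
  have hk := hbig z hz hz0
  -- With `k` non-neighbours of `z`, this reads `(k + 1)|S| ≤ 2(2|S| - 2)`, so `k ≤ 2`; as `z` is
  -- not isolated and `|S| ≤ 2k`, only `k = 2`, `|S| = 4` survives.
  have hle : T.card * S.card ≤ 2 * ∑ u ∈ T, G.nonDegree S u := by
    rw [Finset.mul_sum, ← smul_eq_mul]
    exact Finset.card_nsmul_le_sum _ _ _ hTbig
  have hsplit := Finset.sum_sdiff (f := fun u => G.nonDegree S u) hTS
  have hzc := card_filter_adj_add_nonDegree (G := G) hz
  by_cases hiso : S.card ≤ G.nonDegree S z + 1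
  · exact Or.inl ⟨z, hz, not_adj_of_nonDegree hz hiso⟩
  right
  have hk3 : G.nonDegree S z < 3 := by
    by_contra h
    have := Nat.mul_le_mul_right S.card (show 4 ≤ T.card by omega)
    omega
  have hn : S.card = 4 := by omega
  have hz2 : G.nonDegree S z = 2 := by omega
  have hsd : (S \ T).card = 1 := by
    rw [Finset.card_sdiff_of_subset hTS]
    omega
  obtain ⟨c, hc⟩ := Finset.card_eq_one.1 hsd
  have hcS : c ∈ S \ T := by simp [hc]
  rw [Finset.mem_sdiff] at hcS
  rw [hc, Finset.sum_singleton] at hsplit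
  -- The three vertices of `T` already contribute the whole allowance of `6`.
  have hc0 : G.nonDegree S c = 0 := by
    rw [hTc] at hle
    simp only [hn, hz2] at hle hsum
    omega
  have hmem : ∀ u ∈ S, u ≠ c → u ∈ T := by
    intro u hu huc
    by_contra h
    have : u ∈ S \ T := Finset.mem_sdiff.2 ⟨hu, h⟩
    rw [hc, Finset.mem_singleton] at this
    exact huc this
  refine ⟨hn, c, hcS.1, fun u hu huc => adj_of_nonDegree_eq_zero hc0 hu huc.symm, ?_⟩
  intro u hu x hx huc hxc hux
  have hcu := adj_of_nonDegree_eq_zero hc0 hu huc.symm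
  have h2 : 2 ≤ (S.filter (G.Adj u)).card := by
    have hsub : ({c, x} : Finset V) ⊆ S.filter (G.Adj u) := by
      simp [Finset.insert_subset_iff, hcS.1, hx, hux, hcu.symm]
    have := Finset.card_le_card hsub
    rwa [Finset.card_pair hxc.symm] at this
  have h3 := card_filter_adj_add_nonDegree (G := G) hu
  have h4 := hTbig u (hmem u hu huc)
  omega

/-- If `w` is isolated only after deleting `v`, a path can start `w, v` and continue through the
clique left over, provided `v` has a neighbour there. -/
theorem traceableOn_of_erase_isolated {S : Finset V}
    (hsum : ∑ u ∈ S, G.nonDegree S u + 2 ≤ 2 * S.card) {v w : V} (hv : v ∈ S)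
    (hv0 : G.nonDegree S v ≠ 0) (hw : w ∈ S.erase v) (hiso : ∀ x ∈ S.erase v, ¬ G.Adj w x) :
    G.TraceableOn S ∨ ∃ w ∈ S, ∀ x ∈ S, ¬ G.Adj w x := by
  have hvc := Finset.card_erase_add_one hv
  have hwc := Finset.card_erase_add_one hw
  have hwS := Finset.mem_of_mem_erase hw
  have hwv := Finset.ne_of_mem_erase hw
  by_cases hvw : G.Adj v w
  swap
  · refine Or.inr ⟨w, hwS, fun x hx => ?_⟩
    by_cases hxv : x = v
    · subst hxv
      exact fun h => hvw h.symm
    · exact hiso x (Finset.mem_erase.2 ⟨hxv, hx⟩)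
  have h1 := sum_nonDegree_eq_erase_add (G := G) hv
  have h2 := sum_nonDegree_eq_erase_add (G := G) hw
  have h3 := nonDegree_add_one_of_not_adj hw hiso
  set R := (S.erase v).erase w with hR
  -- Of at most `|S| - 1` non-edges, `w` uses `|S| - 2` inside `S.erase v` and `v` at least one, so
  -- none are left in `R` and `v` has exactly one.
  have h4 : ∑ u ∈ R, G.nonDegree R u = 0 := by omega
  have hclique : ∀ u ∈ R, ∀ x ∈ R, u ≠ x → G.Adj u x := fun u hu x hx hux =>
    adj_of_nonDegree_eq_zero (Finset.sum_eq_zero_iff.1 h4 u hu) hx hux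
  have hmem : ∀ x, x ∈ R ↔ x ≠ w ∧ x ≠ v ∧ x ∈ S := by simp [hR]
  by_cases hy : ∃ y ∈ R, G.Adj v y
  · obtain ⟨y, hyR, hvy⟩ := hy
    left
    have hyc := Finset.card_erase_add_one hyR
    have hy' := (hmem y).1 hyR
    refine traceableOn_of_nodup (w :: v :: y :: (R.erase y).toList) ?_ ?_ ?_ ?_
    · simp [Finset.nodup_toList, hwv, hmem, hy'.1.symm, hy'.2.1.symm]
    · simp only [List.mem_cons, Finset.mem_toList, Finset.mem_erase]
      rintro x (rfl | rfl | rfl | h)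
      · exact hwS
      · exact hv
      · exact hy'.2.2
      · exact ((hmem x).1 h.2).2.2
    · simp only [List.length_cons, Finset.length_toList]
      omega
    · rw [List.isChain_cons_cons, List.isChain_cons_cons]
      refine ⟨hvw.symm, hvy, ?_⟩
      rw [List.isChain_cons]
      refine ⟨fun x hx => ?_, isChain_toList fun u hu x hx => hclique u
        (Finset.mem_of_mem_erase hu) x (Finset.mem_of_mem_erase hx)⟩
      have := List.mem_of_mem_head? hx
      rw [Finset.mem_toList, Finset.mem_erase] at this
      exact hclique y hyR x this.2 this.1.symm
  · push Not at hy
    obtain ⟨x, hx⟩ : (S.filter (Gᶜ.Adj v)).Nonempty :=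
      Finset.card_pos.1 (Nat.pos_of_ne_zero hv0)
    have hsub : R ⊆ S.filter (Gᶜ.Adj v) := by
      intro y hyR
      have := (hmem y).1 hyR
      simp [this.2.2, this.2.1.symm, hy y hyR]
    have hle : R.card ≤ G.nonDegree S v := Finset.card_le_card hsub
    have hR1 : R.card ≤ 1 := by omega
    rw [Finset.mem_filter, compl_adj] at hx
    have hxR : x ∈ R := (hmem x).2 ⟨fun h => hx.2.2 (h ▸ hvw), hx.2.1.symm, hx.1⟩
    refine Or.inr ⟨x, hx.1, fun u hu hxu => ?_⟩
    by_cases huv : u = v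
    · exact hx.2.2 (huv ▸ hxu.symm)
    by_cases huw : u = w
    · subst huw
      exact hiso x (Finset.mem_of_mem_erase hxR) hxu.symm
    · have huR : u ∈ R := (hmem u).2 ⟨huw, huv, hu⟩
      exact hxu.ne (Finset.card_le_one.1 hR1 x hxR u huR)

/-- The claw uses three of at most four non-edges, so `v` is adjacent to two leaves `a`, `b`; the
path is `a, v, b, c, d` with centre `c`. -/
theorem traceableOn_of_erase_isClawOn {S : Finset V}
    (hsum : ∑ u ∈ S, G.nonDegree S u + 2 ≤ 2 * S.card) {v : V} (hv : v ∈ S)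
    (hclaw : G.IsClawOn (S.erase v)) : G.TraceableOn S := by
  obtain ⟨h4, c, hc, hca, hind⟩ := hclaw
  have hvc := Finset.card_erase_add_one hv
  have hQc := Finset.card_erase_add_one hc
  have h1 := sum_nonDegree_eq_erase_add (G := G) hv
  have h2 := sum_nonDegree_eq_erase_add (G := G) hc
  set Q := (S.erase v).erase c with hQ
  have hmem : ∀ x, x ∈ Q ↔ x ≠ c ∧ x ≠ v ∧ x ∈ S := by simp [hQ]
  have h3 : ∀ u ∈ Q, 2 ≤ G.nonDegree Q u := by
    intro u hu
    have hu' := Finset.mem_erase.1 hu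
    have := nonDegree_add_one_of_not_adj (G := G) hu fun x hx =>
      hind u hu'.2 x (Finset.mem_of_mem_erase hx) hu'.1 (Finset.ne_of_mem_erase hx)
    omega
  have h5 := Finset.card_nsmul_le_sum Q (fun u => G.nonDegree Q u) 2 h3
  rw [smul_eq_mul] at h5
  have hv1 : G.nonDegree S v ≤ 1 := by omega
  have hdv := card_filter_adj_add_nonDegree (G := G) hv
  have h6 : (S.filter (G.Adj v)).card ≤ (Q.filter (G.Adj v)).card + 1 := by
    have : S.filter (G.Adj v) ⊆ insert c (Q.filter (G.Adj v)) := by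
      intro x hx
      rw [Finset.mem_filter] at hx
      rw [Finset.mem_insert, Finset.mem_filter, hmem]
      by_cases hxc : x = c
      · exact Or.inl hxc
      · exact Or.inr ⟨⟨hxc, hx.2.ne', hx.1⟩, hx.2⟩
    exact (Finset.card_le_card this).trans (Finset.card_insert_le _ _)
  obtain ⟨a, ha, b, hb, hab⟩ := Finset.one_lt_card.1
    (show 1 < (Q.filter (G.Adj v)).card by omega)
  rw [Finset.mem_filter] at ha hb
  obtain ⟨d, hd⟩ : ((Q.erase a).erase b).Nonempty := by
    rw [← Finset.card_pos, Finset.card_erase_of_mem (Finset.mem_erase.2 ⟨hab.symm, hb.1⟩),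
      Finset.card_erase_of_mem ha.1]
    omega
  simp only [Finset.mem_erase] at hd
  have ha' := (hmem a).1 ha.1
  have hb' := (hmem b).1 hb.1
  have hd' := (hmem d).1 hd.2.2
  have hc' := Finset.mem_erase.1 hc
  refine traceableOn_of_nodup [a, v, b, c, d] ?_ ?_ ?_ ?_
  · simp only [List.nodup_cons, List.mem_cons, List.not_mem_nil, not_or, or_false]
    refine ⟨⟨ha'.2.1, hab, ha'.1, hd.2.1.symm⟩, ⟨hb'.2.1.symm, hc'.1.symm, hd'.2.1.symm⟩,
      ⟨hb'.1, hd.1.symm⟩, hd'.1.symm, ?_⟩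
    simp
  · simp [hv, ha'.2.2, hb'.2.2, hc'.2, hd'.2.2]
  · simp
    omega
  · simp [ha.2.symm, hb.2, (hca b (Finset.mem_of_mem_erase hb.1) hb'.1).symm,
      hca d (Finset.mem_of_mem_erase hd.2.2) hd'.1]

/-- A graph with at most `|S| - 1` missing edges is traceable, has an isolated vertex, or is
`K_{1,3}`. -/
theorem traceableOn_or_isolated_or_isClawOn (n : ℕ) : ∀ S : Finset V, S.card = n →
    ∑ u ∈ S, G.nonDegree S u + 2 ≤ 2 * S.card →
    G.TraceableOn S ∨ (∃ w ∈ S, ∀ x ∈ S, ¬ G.Adj w x) ∨ G.IsClawOn S := by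
  induction n with
  | zero =>
    intro S hS h
    omega
  | succ n ih =>
    intro S hS hsum
    by_cases h0 : ∀ u ∈ S, G.nonDegree S u = 0
    · exact Or.inl ⟨S.toList, S.nodup_toList, S.toList_toFinset,
        isChain_toList fun u hu x hx hux => adj_of_nonDegree_eq_zero (h0 u hu) hx hux⟩
    push Not at h0
    obtain ⟨z, hz, hz0⟩ := h0
    by_cases hgood : ∃ v ∈ S, G.nonDegree S v ≠ 0 ∧ 2 * G.nonDegree S v + 1 ≤ S.card
    · obtain ⟨v, hv, hv0, hvd⟩ := hgood
      have hvc := Finset.card_erase_add_one hv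
      have h1 := sum_nonDegree_eq_erase_add (G := G) hv
      rcases ih (S.erase v) (by omega) (by omega) with h | ⟨w, hw, hiso⟩ | h
      · exact Or.inl (h.of_erase hv hvd)
      · rcases traceableOn_of_erase_isolated hsum hv hv0 hw hiso with h | h
        · exact Or.inl h
        · exact Or.inr (Or.inl h)
      · exact Or.inl (traceableOn_of_erase_isClawOn hsum hv h)
    · push Not at hgood
      exact Or.inr (isolated_or_isClawOn hsum hz hz0 fun v hv hv0 => by
        have := hgood v hv hv0
        omega)

end Traceable

end SimpleGraph

/-! ### Spectral bounds -/

namespace SimpleGraph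

section Spectral

variable {V : Type*} [Fintype V] [Nonempty V] [DecidableEq V] (G : SimpleGraph V)
  [DecidableRel G.Adj]

theorem exists_eigenvector_rho :
    ∃ x : V → ℝ, x ≠ 0 ∧ ∀ i, ∑ j ∈ G.neighborFinset i, x j = G.rho * x i := by
  obtain ⟨k, -, hk⟩ := Finset.exists_mem_eq_sup' (Finset.univ_nonempty (α := V))
    (G.isHermitian_adjMatrix ℝ).eigenvalues
  set b := (G.isHermitian_adjMatrix ℝ).eigenvectorBasis with hb
  refine ⟨⇑(b k), fun h => ?_, fun i => ?_⟩
  · refine b.orthonormal.ne_zero k ?_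
    ext i
    exact congrFun h i
  · have h := congrFun ((G.isHermitian_adjMatrix ℝ).mulVec_eigenvectorBasis k) i
    rw [adjMatrix_mulVec_apply] at h
    rw [h]
    simp [rho, hk, hb]

/-- Stanley's bound `ρ (ρ + 1) ≤ 2m`. -/
theorem rho_sq_add_rho_le_sum_degrees : G.rho ^ 2 + G.rho ≤ ∑ v, (G.degree v : ℝ) := by
  obtain ⟨x, hx0, hx⟩ := G.exists_eigenvector_rho
  set X := ∑ i, x i ^ 2 with hX
  have hXpos : 0 < X := by
    obtain ⟨i, hi⟩ := Function.ne_iff.1 hx0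
    exact Finset.sum_pos' (fun j _ => sq_nonneg _) ⟨i, Finset.mem_univ i, sq_pos_of_ne_zero hi⟩
  -- Cauchy–Schwarz on the eigenvalue equation at `i`, whose sum omits `x i` itself.
  have h1 : ∀ i, G.rho ^ 2 * x i ^ 2 ≤ G.degree i * (X - x i ^ 2) := by
    intro i
    rw [← mul_pow, ← hx i]
    refine (sq_sum_le_card_mul_sum_sq (s := G.neighborFinset i) (f := x)).trans ?_
    rw [card_neighborFinset_eq_degree]
    refine mul_le_mul_of_nonneg_left ?_ (Nat.cast_nonneg _)
    rw [le_sub_iff_add_le, add_comm, ← Finset.sum_insert (f := fun j => x j ^ 2) (by simp)]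
    exact Finset.sum_le_univ_sum_of_nonneg fun j => sq_nonneg _
  have h2 : G.rho ^ 2 * X ≤ (∑ i, (G.degree i : ℝ)) * X - ∑ i, G.degree i * x i ^ 2 := by
    rw [hX, Finset.mul_sum, ← hX, Finset.sum_mul, ← Finset.sum_sub_distrib]
    refine Finset.sum_le_sum fun i _ => ?_
    linarith [h1 i]
  have hrow : ∑ i, ∑ j ∈ G.neighborFinset i, x i * x j = G.rho * X := by
    rw [hX, Finset.mul_sum]
    refine Finset.sum_congr rfl fun i _ => ?_
    rw [← Finset.mul_sum, hx i]
    ring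
  have hdeg : ∑ i, ∑ j ∈ G.neighborFinset i, x i ^ 2 = ∑ i, G.degree i * x i ^ 2 := by
    simp
  have hdeg' : ∑ i, ∑ j ∈ G.neighborFinset i, x j ^ 2 = ∑ i, G.degree i * x i ^ 2 := by
    rw [← hdeg]
    refine Finset.sum_comm' fun i j => ?_
    simp [G.adj_comm]
  have h3 : G.rho * X ≤ ∑ i, G.degree i * x i ^ 2 := by
    have : 0 ≤ ∑ i, ∑ j ∈ G.neighborFinset i, (x i - x j) ^ 2 :=
      Finset.sum_nonneg fun i _ => Finset.sum_nonneg fun j _ => sq_nonneg _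
    have heq : ∑ i, ∑ j ∈ G.neighborFinset i, (x i - x j) ^ 2 =
        ∑ i, ∑ j ∈ G.neighborFinset i, x i ^ 2 + ∑ i, ∑ j ∈ G.neighborFinset i, x j ^ 2 -
          2 * ∑ i, ∑ j ∈ G.neighborFinset i, x i * x j := by
      simp only [Finset.mul_sum, ← Finset.sum_add_distrib, ← Finset.sum_sub_distrib]
      refine Finset.sum_congr rfl fun i _ => Finset.sum_congr rfl fun j _ => ?_
      ring
    rw [heq, hdeg, hdeg', hrow] at this
    linarith
  refine le_of_mul_le_mul_right ?_ hXpos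
  linarith

/-- The spectral radius of the star `K_{1,3}` is less than `2`. -/
theorem rho_lt_two_of_claw (hcard : Fintype.card V = 4) (c : V) (hc : ∀ u, u ≠ c → G.Adj c u)
    (hind : ∀ u w, u ≠ c → w ≠ c → ¬ G.Adj u w) : G.rho < 2 := by
  by_contra hρ
  push Not at hρ
  obtain ⟨x, hx0, hx⟩ := G.exists_eigenvector_rho
  have hcn : G.neighborFinset c = Finset.univ.erase c := by
    ext u
    simp only [mem_neighborFinset, Finset.mem_erase, Finset.mem_univ, and_true]
    exact ⟨fun h => h.ne', hc u⟩
  have hleaf : ∀ u, u ≠ c → x c = G.rho * x u := by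
    intro u hu
    have : G.neighborFinset u = {c} := by
      ext w
      simp only [mem_neighborFinset, Finset.mem_singleton]
      refine ⟨fun h => by_contra fun hw => hind u w hu hw h, ?_⟩
      rintro rfl
      exact (hc u hu).symm
    rw [← hx u, this, Finset.sum_singleton]
  -- The equation at the centre times `ρ`, with each `ρ * x u` replaced by `x c`.
  have hcenter : 3 * x c = G.rho ^ 2 * x c := by
    have h := congrArg (fun t => G.rho * t) (hx c)
    simp only [hcn, Finset.mul_sum] at h
    rw [Finset.sum_congr rfl fun u hu => (hleaf u (Finset.ne_of_mem_erase hu)).symm,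
      Finset.sum_const, Finset.card_erase_of_mem (Finset.mem_univ c), Finset.card_univ, hcard] at h
    norm_num at h
    linarith
  have hxc : x c = 0 := by
    have : (G.rho ^ 2 - 3) * x c = 0 := by linarith
    rcases mul_eq_zero.1 this with h | h
    · nlinarith
    · exact h
  refine hx0 (funext fun u => ?_)
  by_cases hu : u = c
  · rw [hu, hxc, Pi.zero_apply]
  · have := hleaf u hu
    rw [hxc] at this
    rcases mul_eq_zero.1 this.symm with h | h
    · linarith
    · exact h

end Spectral

end SimpleGraph

/-! ### From lists to walks, the exceptional graph, and the conclusion -/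

namespace SimpleGraph

section Final

variable {V : Type*} [Fintype V] [DecidableEq V] {G : SimpleGraph V}

theorem TraceableOn.hasHamiltonPath [Nonempty V] (h : G.TraceableOn Finset.univ) :
    G.HasHamiltonPath := by
  obtain ⟨l, hnd, hl, hc⟩ := h
  have hmem : ∀ x, x ∈ l := fun x => by
    rw [← List.mem_toFinset, hl]
    exact Finset.mem_univ x
  have hne : l ≠ [] := List.ne_nil_of_mem (hmem (Classical.arbitrary V))
  refine ⟨_, _, Walk.ofSupport l hne hc, fun x => ?_⟩
  rw [Walk.support_ofSupport]
  exact List.count_eq_one_of_mem hnd (hmem x)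

/-- A graph with an isolated vertex and all other pairs adjacent is `K_{n-1} + K_1`. -/
theorem nonempty_iso_of_isolated (n : ℕ) (hn : Fintype.card V = n) (w : V)
    (hw : ∀ x, ¬ G.Adj w x) (hK : ∀ u x, u ≠ w → x ≠ w → u ≠ x → G.Adj u x) :
    Nonempty (G ≃g completeGraph (Fin (n - 1)) ⊕g completeGraph (Fin 1)) := by
  have hcard : Fintype.card {x : V // x ≠ w} = n - 1 := by
    rw [Fintype.card_subtype_compl, Fintype.card_subtype_eq, hn]
  let e := (Fintype.equivFinOfCardEq hcard).symm
  let f : Fin (n - 1) ⊕ Fin 1 → V := Sum.elim (fun i => (e i : V)) fun _ => w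
  have hinj : Function.Injective f := by
    rintro (i | i) (j | j) h
    · exact congrArg Sum.inl (e.injective (Subtype.ext h))
    · exact absurd h (e i).2
    · exact absurd h.symm (e j).2
    · exact congrArg Sum.inr (Subsingleton.elim i j)
  have hsurj : Function.Surjective f := by
    intro x
    by_cases hx : x = w
    · exact ⟨Sum.inr 0, hx.symm⟩
    · exact ⟨Sum.inl (e.symm ⟨x, hx⟩), by simp [f]⟩
  refine ⟨RelIso.symm ⟨Equiv.ofBijective f ⟨hinj, hsurj⟩, ?_⟩⟩
  rintro (i | i) (j | j)
  · simp only [f, sum_adj, completeGraph_eq_top, top_adj]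
    refine ⟨fun h hij => h.ne (by rw [hij]), fun h => hK _ _ (e i).2 (e j).2 fun hij => h ?_⟩
    exact e.injective (Subtype.ext hij)
  · exact iff_of_false (fun h => hw _ (G.adj_symm h)) (by simp)
  · exact iff_of_false (hw _) (by simp)
  · simp [f, Subsingleton.elim i j]

omit [Fintype V] in
theorem HasHamiltonPath.preconnected (h : G.HasHamiltonPath) : G.Preconnected := by
  obtain ⟨u, v, p, hp⟩ := h
  intro a b
  exact ⟨(p.takeUntil a (hp.mem_support a)).reverse.append (p.takeUntil b (hp.mem_support b))⟩

omit [Fintype V] in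
theorem not_hasHamiltonPath_of_iso {n : ℕ} (hn : 2 ≤ n)
    (e : G ≃g completeGraph (Fin (n - 1)) ⊕g completeGraph (Fin 1)) : ¬ G.HasHamiltonPath := by
  intro h
  have hr := (h.preconnected (e.symm (Sum.inr 0)) (e.symm (Sum.inl ⟨0, by omega⟩))).map e.toHom
  simp only [RelIso.coe_toRelEmbedding, RelEmbedding.coe_toRelHom, RelIso.apply_symm_apply] at hr
  obtain ⟨p⟩ := hr
  cases p with
  | cons hadj q =>
    rename_i x
    rcases x with x | x
    · simp at hadj
    · simp [Subsingleton.elim x 0] at hadj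

theorem sum_nonDegree_univ_add [DecidableRel G.Adj] :
    ∑ u, (G.nonDegree Finset.univ u : ℝ) + ∑ u, (G.degree u : ℝ) =
      Fintype.card V * (Fintype.card V - 1) := by
  rw [← Finset.sum_add_distrib]
  have h : ∀ u, (G.nonDegree Finset.univ u : ℝ) + G.degree u = Fintype.card V - 1 := by
    intro u
    have := card_filter_adj_add_nonDegree (G := G) (Finset.mem_univ u)
    rw [← neighborFinset_eq_filter, card_neighborFinset_eq_degree, Finset.card_univ] at this
    rw [← this]
    push_cast
    ring
  rw [Finset.sum_congr rfl fun u _ => h u, Finset.sum_const, Finset.card_univ, nsmul_eq_mul]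

end Final

end SimpleGraph

open SimpleGraph in
theorem hasHamiltonPath_or_iso_of_le_rho {V : Type*} [Fintype V] [Nonempty V] [DecidableEq V]
    (G : SimpleGraph V) [DecidableRel G.Adj] (n : ℕ) (hn : Fintype.card V = n)
    (hρ : (n : ℝ) - 2 ≤ G.rho) :
    G.HasHamiltonPath ∨ Nonempty (G ≃g completeGraph (Fin (n - 1)) ⊕g completeGraph (Fin 1)) := by
  have hpos : 0 < n := hn ▸ Fintype.card_pos
  -- Here `n - 2` is negative, so it cannot be substituted into `ρ (ρ + 1)`.
  by_cases h1 : n = 1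
  · have : Subsingleton V := Fintype.card_le_one_iff_subsingleton.1 (by omega)
    exact Or.inl ⟨Classical.arbitrary V, _, Walk.nil, Walk.IsHamiltonian.of_subsingleton⟩
  have h2 : (2 : ℝ) ≤ n := by exact_mod_cast (by omega : 2 ≤ n)
  have hdeg := G.rho_sq_add_rho_le_sum_degrees
  have hsumR := sum_nonDegree_univ_add (G := G)
  rw [hn] at hsumR
  have hsum : ∑ u, G.nonDegree Finset.univ u + 2 ≤ 2 * (Finset.univ : Finset V).card := by
    rw [Finset.card_univ, hn]
    have : (∑ u, (G.nonDegree Finset.univ u : ℝ)) + 2 ≤ 2 * n := by nlinarith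
    exact_mod_cast this
  rcases traceableOn_or_isolated_or_isClawOn (G := G) _ Finset.univ rfl hsum with
    h | ⟨w, hw, hiso⟩ | ⟨h4, c, -, hc, hind⟩
  · exact Or.inl h.hasHamiltonPath
  · refine Or.inr (nonempty_iso_of_isolated n hn w (fun x => hiso x (Finset.mem_univ x)) ?_)
    have h3 := sum_nonDegree_eq_erase_add (G := G) hw
    have h4 := nonDegree_add_one_of_not_adj hw hiso
    -- The isolated `w` exhausts the allowance `2n - 2`.
    have h0 : ∑ u ∈ Finset.univ.erase w, G.nonDegree (Finset.univ.erase w) u = 0 := by omega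
    intro u x hu hx hux
    exact adj_of_nonDegree_eq_zero (Finset.sum_eq_zero_iff.1 h0 u (by simp [hu])) (by simp [hx]) hux
  · rw [Finset.card_univ] at h4
    have hlt := G.rho_lt_two_of_claw h4 c (fun u hu => hc u (Finset.mem_univ u) hu)
      fun u x hu hx => hind u (Finset.mem_univ u) x (Finset.mem_univ x) hu hx
    rw [← hn, h4] at hρ
    norm_num at hρ
    linarith

theorem corollary1 {V : Type*} [Fintype V] [Nonempty V] [DecidableEq V]
    (G : SimpleGraph V) [DecidableRel G.Adj] (n : ℕ) (hn : Fintype.card V = n)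
    (hρ : (n : ℝ) - 2 ≤ G.rho) :
    (G.HasHamiltonPath ∨
      Nonempty (G ≃g
        SimpleGraph.completeGraph (Fin (n - 1)) ⊕g SimpleGraph.completeGraph (Fin 1))) ∧
    (2 ≤ n →
      Nonempty (G ≃g
        SimpleGraph.completeGraph (Fin (n - 1)) ⊕g SimpleGraph.completeGraph (Fin 1)) →
      ¬ G.HasHamiltonPath) :=
  ⟨hasHamiltonPath_or_iso_of_le_rho G n hn hρ,
    fun h2 ⟨e⟩ => SimpleGraph.not_hasHamiltonPath_of_iso h2 e⟩
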